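/- **Lemma (adaptive randomized Lanczos).** Let $n\ge 1$, let $H\in\mathbb{R}^{n\times n}$ be symmetric, $\epsilon>0$ and $\delta\in[0,1)$; $\|H\|$ is the spectral norm and $\lambda_{\min}(H)$ the smallest eigenvalue. For a unit vector $b$ and $j\ge 1$ let $\xi_{\min}(H,b,j)$ and $\xi_{\max}(H,b,j)$ be the minimum and maximum of $z^\top Hz$ over the unit vectors $z$ in the Krylov subspace $\mathrm{span}\{b,Hb,\dots,H^{j-1}b\}$ explored by $j$ iterations of the Lanczos process started at $b$. Each iteration uses one matrix-vector product with $H$ (the process ends early if the Krylov subspace is already invariant). Consider the following method, which takes $n,\epsilon,\delta,b$ as inputs and accesses $H$ only through matrix-vector products (in particular, it is given no bound on $\|H\|$). 1. Perform $j_M=\min\{n,\,1+\lceil\frac12\ln(25n/\delta^2)\rceil\}$ Lanczos iterations from $b$ and set $M=2\max\{|\xi_{\max}(H,b,j_M)|,|\xi_{\min}(H,b,j_M)|\}$. 2. Set $j_{\rm total}=\min\{n,\,1+\lceil\frac12\ln(25n/\delta^2)\sqrt{M/\epsilon}\rceil\}$, perform $\max\{0,j_{\rm total}-j_M\}$ further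 iterations, and put $\lambda=\xi_{\min}(H,b,j_{\rm total})$. 3. Output $\lambda$, together with a unit vector $v$ with $v^\top Hv=\lambda$ if $\lambda\le-\epsilon/2$, and otherwise with the certificate that $\lambda_{\min}(H)\ge-\epsilon$. For $\delta=0$ the logarithm is read as $+\infty$, so that $j_M$, $j_{\rm total}$ and the bound below equal $n$. For every unit vector $b$, implementing the iterations by the Lanczos three-term recurrence and computing the quantities above from the stored Lanczos vectors and their products with $H$ yields exactly these values of $M$ and $\lambda$, and an output as described in step 3. If $b$ is uniformly distributed on the unit sphere of $\mathbb{R}^n$, then with probability at least $1-\delta$ all of the following hold: $\|H\|\le M\le 2\|H\|$; the output satisfies $$\lambda\le\lambda_{\min}(H)+\tfrac{\epsilon}{2};$$ and the number of matrix-vector products with $H$ is at most $$\min\Big\{n,\;1+\max\Big\{\big\lceil\tfrac12\ln(25n/\delta^2)\big\rceil,\ \Big\lceil\tfrac12\ln(25n/\delta^2)\sqrt{2\|H\|/\epsilon}\Big\rceil\Big\}\Big\}.$$ -/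

import Mathlib

open MeasureTheory
open scoped RealInnerProductSpace

noncomputable section

/-- Real vectors of length `n` with the Euclidean norm. -/
abbrev Vec (n : ℕ) : Type := EuclideanSpace ℝ (Fin n)

/-- The product of the matrix `H` with the vector `v`. -/
def matVec {n : ℕ} (H : Matrix (Fin n) (Fin n) ℝ) (v : Vec n) : Vec n :=
  Matrix.toEuclideanCLM (n := Fin n) (𝕜 := ℝ) H v

/-- The spectral norm (the operator norm for the Euclidean norm). -/
def specNorm {n : ℕ} (H : Matrix (Fin n) (Fin n) ℝ) : ℝ :=
  ‖Matrix.toEuclideanCLM (n := Fin n) (𝕜 := ℝ) H‖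

/-- The smallest eigenvalue of a symmetric matrix. -/
def lambdaMin {n : ℕ} (H : Matrix (Fin n) (Fin n) ℝ) : ℝ :=
  sInf {μ : ℝ | Module.End.HasEigenvalue (Matrix.toLin' H) μ}

/-- The uniform probability distribution on the unit sphere: the normalized surface measure. -/
def uniformSphere (n : ℕ) : Measure (Metric.sphere (0 : Vec n) 1) :=
  ((volume : Measure (Vec n)).toSphere Set.univ)⁻¹ • (volume : Measure (Vec n)).toSphere

/-! ### Krylov subspaces and Ritz values -/

/-- The Krylov subspace `span {b, H b, …, H ^ (j - 1) b}` that `j` iterations of Lanczos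
explore. -/
def krylov {n : ℕ} (H : Matrix (Fin n) (Fin n) ℝ) (b : Vec n) (j : ℕ) : Submodule ℝ (Vec n) :=
  Submodule.span ℝ {v | ∃ i < j, v = (matVec H)^[i] b}

/-- The smallest Ritz value after `j` iterations. -/
def xiMin {n : ℕ} (H : Matrix (Fin n) (Fin n) ℝ) (b : Vec n) (j : ℕ) : ℝ :=
  sInf {x | ∃ z ∈ krylov H b j, ‖z‖ = 1 ∧ x = ⟪z, matVec H z⟫}

/-- The largest Ritz value after `j` iterations. -/
def xiMax {n : ℕ} (H : Matrix (Fin n) (Fin n) ℝ) (b : Vec n) (j : ℕ) : ℝ :=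
  sSup {x | ∃ z ∈ krylov H b j, ‖z‖ = 1 ∧ x = ⟪z, matVec H z⟫}

/-! ### Programs that access the matrix only through matrix-vector products -/

/-- A program over an unknown matrix: it either ends with a result, or asks for the product of
the matrix with a vector `v` and goes on with the answer. -/
inductive MatVecProg (n : ℕ) (α : Type) : Type where
  | done (a : α) : MatVecProg n α
  | query (v : Vec n) (next : Vec n → MatVecProg n α) : MatVecProg n α

namespace MatVecProg

/-- Sequential composition of programs. -/
def bind {n : ℕ} {α β : Type} : MatVecProg n α → (α → MatVecProg n β) → MatVecProg n β
  | done a, f => f a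
  | query v next, f => query v (fun w => (next w).bind f)

/-- The result of the program on the matrix `H`, and the number of products with `H` that it
asked for. -/
def run {n : ℕ} {α : Type} (H : Matrix (Fin n) (Fin n) ℝ) : MatVecProg n α → α × ℕ
  | done a => (a, 0)
  | query v next => (((next (matVec H v)).run H).1, ((next (matVec H v)).run H).2 + 1)

end MatVecProg

/-! ### The Lanczos process -/

/-- The state of the Lanczos process: the Lanczos vectors `q` found so far with their products
`H q`, the last of these vectors, the next one (zero after a breakdown, that is, when the Krylov
subspace is already invariant), and the last off-diagonal coefficient. -/
structure LanczosState (n : ℕ) where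
  pairs : List (Vec n × Vec n)
  prev : Vec n
  next : Vec n
  beta : ℝ

namespace LanczosState

/-- The initial state, with starting vector `b`. -/
def init {n : ℕ} (b : Vec n) : LanczosState n := ⟨[], 0, b, 0⟩

/-- The residual of the three-term recurrence, where `w` is the product of the matrix with the
current Lanczos vector. -/
def residual {n : ℕ} (s : LanczosState n) (w : Vec n) : Vec n :=
  w - ⟪s.next, w⟫ • s.next - s.beta • s.prev

/-- One Lanczos step, where `w` is the product of the matrix with the current Lanczos vector. -/
def step {n : ℕ} (s : LanczosState n) (w : Vec n) : LanczosState n :=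
  ⟨s.pairs ++ [(s.next, w)], s.next, ‖s.residual w‖⁻¹ • s.residual w, ‖s.residual w‖⟩

/-- The pairs `(z, H z)` for `z` in the span of the first `j` Lanczos vectors, as far as these
exist; they are linear combinations of the stored pairs. -/
def ritzSpace {n : ℕ} (s : LanczosState n) (j : ℕ) : Submodule ℝ (Vec n × Vec n) :=
  Submodule.span ℝ {p | p ∈ s.pairs.take j}

/-- The smallest Ritz value of the first `j` iterations, from the stored pairs. -/
def ritzMin {n : ℕ} (s : LanczosState n) (j : ℕ) : ℝ :=
  sInf {x | ∃ p ∈ s.ritzSpace j, ‖p.1‖ = 1 ∧ x = ⟪p.1, p.2⟫}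

/-- The largest Ritz value of the first `j` iterations, from the stored pairs. -/
def ritzMax {n : ℕ} (s : LanczosState n) (j : ℕ) : ℝ :=
  sSup {x | ∃ p ∈ s.ritzSpace j, ‖p.1‖ = 1 ∧ x = ⟪p.1, p.2⟫}

/-- A unit vector that attains the smallest Ritz value of the first `j` iterations. -/
def ritzVec {n : ℕ} (s : LanczosState n) (j : ℕ) : Vec n :=
  Classical.epsilon fun z : Vec n =>
    ‖z‖ = 1 ∧ ∃ w : Vec n, (z, w) ∈ s.ritzSpace j ∧ ⟪z, w⟫ = s.ritzMin j

end LanczosState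

open Classical in
/-- `k` further Lanczos iterations from the state `s`, each with one matrix-vector product
(ending early at a breakdown). -/
def lanczosIterate {n : ℕ} : ℕ → LanczosState n → MatVecProg n (LanczosState n)
  | 0, s => .done s
  | k + 1, s =>
      if s.next = 0 then .done s
      else .query s.next (fun w => lanczosIterate k (s.step w))

/-! ### The Lanczos method with estimation of an upper bound on the norm -/

open Classical in
/-- The iteration limit `min {n, 1 + ⌈½ ln (25 n / δ²) · c⌉}`. For `δ = 0` the logarithm is read
as `+∞` and the limit is `n`. -/
def iterLimit (n : ℕ) (δ c : ℝ) : ℕ :=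
  if δ = 0 then n else min n (1 + ⌈1 / 2 * Real.log (25 * n / δ ^ 2) * c⌉₊)

/-- The length of the first phase. -/
def jM (n : ℕ) (δ : ℝ) : ℕ := iterLimit n δ 1

/-- The iteration limit that belongs to the value `M` of the norm estimate. -/
def jTotal (n : ℕ) (ε δ M : ℝ) : ℕ := iterLimit n δ (√(M / ε))

/-- The output: the estimate of the norm (an internal quantity), the estimate of the smallest
eigenvalue, and either a direction of negative curvature or (`none`) the certificate that no
eigenvalue is below `-ε`. -/
structure LanczosOutput (n : ℕ) where
  normEst : ℝ
  eigEst : ℝ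
  direction : Option (Vec n)

open Classical in
/-- The final stage: evaluate the smallest Ritz value after `j` iterations. -/
def finish {n : ℕ} (ε M : ℝ) (j : ℕ) (s : LanczosState n) : LanczosOutput n :=
  ⟨M, s.ritzMin j, if s.ritzMin j ≤ -ε / 2 then some (s.ritzVec j) else none⟩

/-- The norm estimate after the first phase. -/
def normEstimate {n : ℕ} (δ : ℝ) (s : LanczosState n) : ℝ :=
  2 * max |s.ritzMax (jM n δ)| |s.ritzMin (jM n δ)|

/-- The second phase: `max {0, j_total - j_M}` further iterations (the subtraction in `ℕ`
truncates). -/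
def secondPhase {n : ℕ} (ε δ M : ℝ) (s : LanczosState n) : MatVecProg n (LanczosOutput n) :=
  (lanczosIterate (jTotal n ε δ M - jM n δ) s).bind fun s' =>
    .done (finish ε M (jTotal n ε δ M) s')

/-- The Lanczos method with estimation of an upper bound on the norm, with tolerance `ε`, failure
probability `δ` and starting vector `b`. It knows nothing about the matrix beyond the products
that it asks for. -/
def adaptiveLanczos {n : ℕ} (ε δ : ℝ) (b : Vec n) : MatVecProg n (LanczosOutput n) :=
  (lanczosIterate (jM n δ) (LanczosState.init b)).bind fun s =>
    secondPhase ε δ (normEstimate δ s) s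

open Classical in
/-- The bound `min {n, 1 + max {⌈½ ln (25 n / δ²)⌉, ⌈½ ln (25 n / δ²) √(2 h / ε)⌉}}`, where `h` is
the norm of the matrix; for `δ = 0` the logarithm is read as `+∞` and the bound is `n`. -/
def productBound (n : ℕ) (ε δ h : ℝ) : ℕ :=
  if δ = 0 then n
  else min n (1 + max ⌈1 / 2 * Real.log (25 * n / δ ^ 2)⌉₊
    ⌈1 / 2 * Real.log (25 * n / δ ^ 2) * √(2 * h / ε)⌉₊)

end

/-!
The Lanczos part is deterministic. The state of the process satisfies `LanczosState.Invariant`: the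
vectors found so far are orthonormal and span the Krylov subspaces. Symmetry of `H` makes the
three-term residual orthogonal to all of them, since `H` maps all but the last of them into a
subspace orthogonal to the next one. So the stored pairs `(z, H z)` form the graph of `H` over the
Krylov subspace, also after a breakdown, where the Krylov subspaces are constant, and the Ritz
values computed from them are the true ones (`adaptiveLanczos_run`).

The probabilistic part rests on a single event: the components of `b` along a unit eigenvector for
the smallest eigenvalue and along one for the largest both exceed `2 δ / (5 √n)` in absolute value.

* The event has probability at least `1 - δ` (`le_uniformSphere_lt_abs_inner`). The surface measure
  is a cone measure, so the probability that one component is at most `t` in absolute value is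
  bounded by the share of the slab of width `2 t` in the unit ball, and log-convexity of the Gamma
  function bounds that share by `5 / 4 * t * √n`.

* On the event, Ritz values are accurate (`xiMin_iterLimit_le`, after Kuczyński and Woźniakowski).
  Let the spectrum lie in `[μ, μ + R]`, where `μ` is the smallest eigenvalue, and let `b₀` be the
  component of `b` along its eigenvector. The vector `p(H) b`, with `p` a rescaled Chebyshev
  polynomial of the fourth kind of degree `k`, has Rayleigh quotient at most `μ + θ` as soon as
  `|b₀| cosh ((2 k + 1) √(θ / R)) ≥ 1`: the polynomial is chosen so that `p(x)² (x - μ - θ)` is at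
  most `R - θ` on the spectrum, while `p(μ)² θ` is at least
  `(R - θ) sinh² ((2 k + 1) √(θ / R))`. The iteration limits are such that this holds with
  `exp ((2 k + 1) √(θ / R)) ≥ 5 √n / δ`. If the limit is `n`, which includes the case `δ = 0`, then
  `p` is instead the product of `x - y` over the other eigenvalues `y`, and the Ritz value is exact.

The first phase is the case `θ = ‖H‖ / 2`, `R = 2 ‖H‖`, for `H` or for `-H` according to the sign of
an eigenvalue of largest modulus (`specNorm_le_two_mul_max`). The second is the case `θ = ε / 2`,
`R = 2 M` with `M ≥ ‖H‖` (`xiMin_jTotal_le`). Since the same event serves both phases, the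
dependence of `M` on `b` does no harm.
-/

/-! ### Krylov subspaces -/

/-- Multiplication by `H` as a linear map. -/
noncomputable abbrev matLin {n : ℕ} (H : Matrix (Fin n) (Fin n) ℝ) : Vec n →ₗ[ℝ] Vec n :=
  (Matrix.toEuclideanCLM (n := Fin n) (𝕜 := ℝ) H : Vec n →L[ℝ] Vec n)

section Krylov

variable {n : ℕ} {H : Matrix (Fin n) (Fin n) ℝ} {b : Vec n}

theorem matLin_apply (v : Vec n) : matLin H v = matVec H v := rfl

theorem matVec_add (v w : Vec n) : matVec H (v + w) = matVec H v + matVec H w :=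
  (matLin H).map_add v w

theorem matVec_smul (c : ℝ) (v : Vec n) : matVec H (c • v) = c • matVec H v :=
  (matLin H).map_smul c v

theorem continuous_matVec : Continuous (matVec H) :=
  (Matrix.toEuclideanCLM (n := Fin n) (𝕜 := ℝ) H).continuous

theorem inner_matVec_comm (hH : H.IsSymm) (v w : Vec n) :
    ⟪v, matVec H w⟫ = ⟪matVec H v, w⟫ := by
  have h : (Matrix.toEuclideanLin H).IsSymmetric :=
    Matrix.isSymmetric_toEuclideanLin_iff.mpr (by
      rw [Matrix.IsHermitian, Matrix.conjTranspose_eq_transpose_of_trivial]; exact hH)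
  exact (h v w).symm

theorem iterate_mem_krylov {i j : ℕ} (h : i < j) : (matVec H)^[i] b ∈ krylov H b j :=
  Submodule.subset_span ⟨i, h, rfl⟩

theorem krylov_mono {i j : ℕ} (h : i ≤ j) : krylov H b i ≤ krylov H b j :=
  Submodule.span_mono fun _ ⟨k, hk, e⟩ => ⟨k, hk.trans_le h, e⟩

theorem krylov_zero : krylov H b 0 = ⊥ := by simp [krylov]

theorem krylov_succ (j : ℕ) :
    krylov H b (j + 1) = krylov H b j ⊔ Submodule.span ℝ {(matVec H)^[j] b} := by
  rw [krylov, krylov, ← Submodule.span_union]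
  congr 1
  ext v
  simp only [Set.mem_ofPred_eq, Set.mem_union, Set.mem_singleton_iff]
  constructor
  · rintro ⟨i, hi, rfl⟩
    rcases Nat.lt_succ_iff_lt_or_eq.mp hi with h | rfl
    · exact Or.inl ⟨i, h, rfl⟩
    · exact Or.inr rfl
  · rintro (⟨i, hi, rfl⟩ | rfl)
    · exact ⟨i, by omega, rfl⟩
    · exact ⟨j, by omega, rfl⟩

theorem matVec_mem_krylov_succ {j : ℕ} {z : Vec n} (hz : z ∈ krylov H b j) :
    matVec H z ∈ krylov H b (j + 1) := by
  have : krylov H b j ≤ (krylov H b (j + 1)).comap (matLin H) := by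
    refine Submodule.span_le.mpr ?_
    rintro _ ⟨i, hi, rfl⟩
    have := iterate_mem_krylov (H := H) (b := b) (Nat.succ_lt_succ hi)
    rwa [Function.iterate_succ_apply'] at this
  exact this hz

theorem sup_span_singleton_eq_of_sub_mem {K : Submodule ℝ (Vec n)} {x y : Vec n}
    (h : x - y ∈ K) : K ⊔ Submodule.span ℝ {x} = K ⊔ Submodule.span ℝ {y} := by
  have key : ∀ u v : Vec n, u - v ∈ K → K ⊔ Submodule.span ℝ {u} ≤ K ⊔ Submodule.span ℝ {v} := by
    intro u v huv
    refine sup_le le_sup_left ?_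
    rw [Submodule.span_singleton_le_iff_mem, ← sub_add_cancel u v]
    exact Submodule.add_mem_sup huv (Submodule.mem_span_singleton_self v)
  exact le_antisymm (key _ _ h) (key _ _ (by simpa using K.neg_mem h))

theorem krylov_succ_succ {m : ℕ} {q : Vec n}
    (hq : krylov H b (m + 1) = krylov H b m ⊔ Submodule.span ℝ {q}) :
    krylov H b (m + 2) = krylov H b (m + 1) ⊔ Submodule.span ℝ {matVec H q} := by
  apply le_antisymm
  · rw [krylov_succ (m + 1)]
    refine sup_le le_sup_left ?_
    rw [Submodule.span_singleton_le_iff_mem, Function.iterate_succ_apply']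
    have hm := iterate_mem_krylov (H := H) (b := b) (Nat.lt_succ_self m)
    rw [Nat.succ_eq_add_one, hq] at hm
    obtain ⟨y, hy, c, hc, e⟩ := Submodule.mem_sup.mp hm
    obtain ⟨a, rfl⟩ := Submodule.mem_span_singleton.mp hc
    rw [← e, matVec_add, matVec_smul]
    exact Submodule.add_mem_sup (matVec_mem_krylov_succ hy)
      (Submodule.smul_mem _ _ (Submodule.mem_span_singleton_self _))
  · refine sup_le (krylov_mono (by omega)) ?_
    rw [Submodule.span_singleton_le_iff_mem]
    apply matVec_mem_krylov_succ
    rw [hq]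
    exact Submodule.mem_sup_right (Submodule.mem_span_singleton_self _)

theorem krylov_eq_of_succ_eq {m : ℕ} (h : krylov H b (m + 1) = krylov H b m) {j : ℕ}
    (hj : m ≤ j) : krylov H b j = krylov H b m := by
  induction j, hj using Nat.le_induction with
  | base => rfl
  | succ j hj ih =>
    apply le_antisymm _ (krylov_mono (by omega))
    rw [krylov_succ, ih]
    refine sup_le le_rfl ?_
    rw [Submodule.span_singleton_le_iff_mem]
    rcases hj.eq_or_lt with rfl | hlt
    · rw [← h]
      exact iterate_mem_krylov (Nat.lt_succ_self _)
    · obtain ⟨i, rfl⟩ : ∃ i, j = i + 1 := ⟨j - 1, by omega⟩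
      rw [← h, Function.iterate_succ_apply']
      apply matVec_mem_krylov_succ
      rw [← ih]
      exact iterate_mem_krylov (Nat.lt_succ_self _)

end Krylov

/-! ### Ritz values -/

section Ritz

variable {n : ℕ} {H : Matrix (Fin n) (Fin n) ℝ} {b : Vec n}

theorem abs_inner_matVec_le {z : Vec n} (hz : ‖z‖ = 1) : |⟪z, matVec H z⟫| ≤ specNorm H := by
  refine (abs_real_inner_le_norm _ _).trans ?_
  rw [hz, one_mul]
  have := (Matrix.toEuclideanCLM (n := Fin n) (𝕜 := ℝ) H).le_opNorm z
  rwa [hz, mul_one] at this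

/-- The Ritz values after `j` iterations are attained: the unit sphere of the Krylov subspace is
compact and nonempty. -/
theorem isCompact_ritzValues (j : ℕ) :
    IsCompact {x | ∃ z ∈ krylov H b j, ‖z‖ = 1 ∧ x = ⟪z, matVec H z⟫} := by
  have hK : IsCompact ((krylov H b j : Set (Vec n)) ∩ Metric.sphere 0 1) :=
    (isCompact_sphere 0 1).inter_left (krylov H b j).closed_of_finiteDimensional
  convert hK.image (f := fun z => ⟪z, matVec H z⟫) (by have := continuous_matVec (H := H); fun_prop)
    using 1
  ext x
  simp only [Set.mem_ofPred_eq, Set.mem_image, Set.mem_inter_iff, SetLike.mem_coe,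
    mem_sphere_zero_iff_norm]
  constructor
  · rintro ⟨z, h1, h2, rfl⟩
    exact ⟨z, ⟨h1, h2⟩, rfl⟩
  · rintro ⟨z, ⟨h1, h2⟩, rfl⟩
    exact ⟨z, h1, h2, rfl⟩

theorem ritzValues_nonempty (hb : ‖b‖ = 1) {j : ℕ} (hj : 1 ≤ j) :
    {x | ∃ z ∈ krylov H b j, ‖z‖ = 1 ∧ x = ⟪z, matVec H z⟫}.Nonempty :=
  ⟨_, b, iterate_mem_krylov (i := 0) hj, hb, rfl⟩

theorem exists_eq_xiMin (hb : ‖b‖ = 1) {j : ℕ} (hj : 1 ≤ j) :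
    ∃ z ∈ krylov H b j, ‖z‖ = 1 ∧ xiMin H b j = ⟪z, matVec H z⟫ :=
  (isCompact_ritzValues j).sInf_mem (ritzValues_nonempty hb hj)

theorem exists_eq_xiMax (hb : ‖b‖ = 1) {j : ℕ} (hj : 1 ≤ j) :
    ∃ z ∈ krylov H b j, ‖z‖ = 1 ∧ xiMax H b j = ⟪z, matVec H z⟫ :=
  (isCompact_ritzValues j).sSup_mem (ritzValues_nonempty hb hj)

theorem xiMin_le_inner {j : ℕ} {z : Vec n} (hz : z ∈ krylov H b j) (hz1 : ‖z‖ = 1) :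
    xiMin H b j ≤ ⟪z, matVec H z⟫ :=
  csInf_le (isCompact_ritzValues j).bddBelow ⟨z, hz, hz1, rfl⟩

theorem le_xiMax_inner {j : ℕ} {z : Vec n} (hz : z ∈ krylov H b j) (hz1 : ‖z‖ = 1) :
    ⟪z, matVec H z⟫ ≤ xiMax H b j :=
  le_csSup (isCompact_ritzValues j).bddAbove ⟨z, hz, hz1, rfl⟩

theorem abs_xiMin_le (hb : ‖b‖ = 1) {j : ℕ} (hj : 1 ≤ j) : |xiMin H b j| ≤ specNorm H := by
  obtain ⟨z, -, hz, e⟩ := exists_eq_xiMin (H := H) hb hj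
  exact e ▸ abs_inner_matVec_le hz

theorem abs_xiMax_le (hb : ‖b‖ = 1) {j : ℕ} (hj : 1 ≤ j) : |xiMax H b j| ≤ specNorm H := by
  obtain ⟨z, -, hz, e⟩ := exists_eq_xiMax (H := H) hb hj
  exact e ▸ abs_inner_matVec_le hz

end Ritz

/-! ### Correctness of the Lanczos recurrence -/

namespace LanczosState

variable {n : ℕ} {H : Matrix (Fin n) (Fin n) ℝ} {b : Vec n} {s : LanczosState n}

/-- The invariant of the Lanczos process, where `m` vectors have been found: the first `i ≤ m` of
them span the Krylov subspace of order `i`, and the next one spans the rest of the Krylov subspace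
of order `m + 1`, to which it contributes the orthogonal complement of that of order `m`. The last
field is what makes a three-term recurrence sufficient: the Krylov subspace of order `m` is spanned
by the last vector and a subspace that `H` maps into it. For `m = 0`, where the last vector is
zero, that subspace is trivial. -/
structure Invariant (H : Matrix (Fin n) (Fin n) ℝ) (b : Vec n) (s : LanczosState n) : Prop where
  pair : ∀ p ∈ s.pairs, p.2 = matVec H p.1
  span_take : ∀ i ≤ s.pairs.length,
    Submodule.span ℝ (Prod.fst '' {p | p ∈ s.pairs.take i}) = krylov H b i
  krylov_succ : krylov H b (s.pairs.length + 1) =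
    krylov H b s.pairs.length ⊔ Submodule.span ℝ {s.next}
  orth : ∀ z ∈ krylov H b s.pairs.length, ⟪z, s.next⟫ = 0
  unit : s.next ≠ 0 → ‖s.next‖ = 1
  prev : ∃ K : Submodule ℝ (Vec n),
    krylov H b s.pairs.length = K ⊔ Submodule.span ℝ {s.prev} ∧
    (∀ z ∈ K, matVec H z ∈ krylov H b s.pairs.length ∧ ⟪z, s.prev⟫ = 0) ∧
    ⟪s.prev, matVec H s.next⟫ = s.beta * ⟪s.prev, s.prev⟫

theorem invariant_init (hb : ‖b‖ = 1) : Invariant H b (init b) where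
  pair := by simp [init]
  span_take := by simp [init, krylov_zero]
  krylov_succ := by simp [init, _root_.krylov_succ]
  orth := by simp [init, krylov_zero]
  unit := fun _ => hb
  prev := ⟨⊥, by simp [init, krylov_zero, ← matLin_apply]⟩

/-- The residual is orthogonal to all Lanczos vectors so far. -/
theorem Invariant.inner_residual (hH : H.IsSymm) (hs : Invariant H b s) (h0 : s.next ≠ 0)
    {z : Vec n} (hz : z ∈ krylov H b (s.pairs.length + 1)) :
    ⟪z, s.residual (matVec H s.next)⟫ = 0 := by
  obtain ⟨K, hK, hHK, hβ⟩ := hs.prev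
  have hprev : s.prev ∈ krylov H b s.pairs.length := by
    rw [hK]
    exact Submodule.mem_sup_right (Submodule.mem_span_singleton_self _)
  have hnp := hs.orth _ hprev
  have hnext : ⟪s.next, s.residual (matVec H s.next)⟫ = 0 := by
    rw [residual, inner_sub_right, inner_sub_right, inner_smul_right, inner_smul_right,
      real_inner_self_eq_norm_sq, hs.unit h0, real_inner_comm s.prev s.next, hnp]
    ring
  have hprev' : ⟪s.prev, s.residual (matVec H s.next)⟫ = 0 := by
    rw [residual, inner_sub_right, inner_sub_right, inner_smul_right, inner_smul_right, hβ, hnp]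
    ring
  have hKK : ∀ y ∈ K, ⟪y, s.residual (matVec H s.next)⟫ = 0 := by
    intro y hy
    have hyk : y ∈ krylov H b s.pairs.length := hK ▸ Submodule.mem_sup_left hy
    rw [residual, inner_sub_right, inner_sub_right, inner_smul_right, inner_smul_right,
      inner_matVec_comm hH, hs.orth _ (hHK y hy).1, hs.orth y hyk, (hHK y hy).2]
    ring
  rw [hs.krylov_succ, hK] at hz
  obtain ⟨u, hu, v, hv, rfl⟩ := Submodule.mem_sup.mp hz
  obtain ⟨y, hy, w, hw, rfl⟩ := Submodule.mem_sup.mp hu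
  obtain ⟨c, rfl⟩ := Submodule.mem_span_singleton.mp hv
  obtain ⟨d, rfl⟩ := Submodule.mem_span_singleton.mp hw
  simp [inner_add_left, inner_smul_left, hnext, hprev', hKK y hy]

theorem Invariant.step (hH : H.IsSymm) (hs : Invariant H b s) (h0 : s.next ≠ 0) :
    Invariant H b (s.step (matVec H s.next)) := by
  have hlen : (s.step (matVec H s.next)).pairs.length = s.pairs.length + 1 := by
    simp [LanczosState.step]
  have hprev : s.prev ∈ krylov H b s.pairs.length := by
    obtain ⟨K, hK, -⟩ := hs.prev
    rw [hK]
    exact Submodule.mem_sup_right (Submodule.mem_span_singleton_self _)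
  have hnextmem : s.next ∈ krylov H b (s.pairs.length + 1) := by
    rw [hs.krylov_succ]
    exact Submodule.mem_sup_right (Submodule.mem_span_singleton_self _)
  have hres : matVec H s.next - s.residual (matVec H s.next) ∈
      krylov H b (s.pairs.length + 1) := by
    rw [residual, sub_sub, sub_sub_cancel]
    exact add_mem (Submodule.smul_mem _ _ hnextmem)
      (Submodule.smul_mem _ _ (krylov_mono (Nat.le_succ _) hprev))
  refine ⟨?_, ?_, ?_, ?_, ?_, ?_⟩
  · intro p hp
    simp only [LanczosState.step, List.mem_append, List.mem_singleton] at hp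
    rcases hp with hp | rfl
    · exact hs.pair p hp
    · rfl
  · intro i hi
    rw [hlen] at hi
    simp only [LanczosState.step]
    rcases Nat.lt_or_ge s.pairs.length i with h | h
    · obtain rfl : i = s.pairs.length + 1 := by omega
      rw [List.take_of_length_le (by simp), hs.krylov_succ, ← hs.span_take _ le_rfl,
        List.take_length, ← Submodule.span_union]
      congr 1
      ext v
      simp only [List.mem_append, List.mem_singleton, Set.mem_image, Set.mem_ofPred_eq,
        Set.mem_union, Set.mem_singleton_iff]
      constructor
      · rintro ⟨p, hp | rfl, rfl⟩
        · exact Or.inl ⟨p, hp, rfl⟩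
        · exact Or.inr rfl
      · rintro (⟨p, hp, rfl⟩ | rfl)
        · exact ⟨p, Or.inl hp, rfl⟩
        · exact ⟨_, Or.inr rfl, rfl⟩
    · rw [List.take_append_of_le_length h]
      exact hs.span_take i h
  · rw [hlen, krylov_succ_succ hs.krylov_succ, sup_span_singleton_eq_of_sub_mem hres]
    congr 1
    simp only [LanczosState.step]
    rcases eq_or_ne (s.residual (matVec H s.next)) 0 with h | h
    · rw [h, smul_zero]
    · exact (Submodule.span_singleton_smul_eq
        (IsUnit.mk0 _ (inv_ne_zero (norm_ne_zero_iff.mpr h))) _).symm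
  · intro z hz
    rw [hlen] at hz
    simp [LanczosState.step, inner_smul_right, hs.inner_residual hH h0 hz]
  · intro h
    simp only [LanczosState.step] at h ⊢
    rw [norm_smul, norm_inv, norm_norm, inv_mul_cancel₀]
    intro h'
    simp [h'] at h
  · refine ⟨krylov H b s.pairs.length, ?_, ?_, ?_⟩
    · rw [hlen, hs.krylov_succ]
      rfl
    · intro z hz
      rw [hlen]
      exact ⟨matVec_mem_krylov_succ hz, hs.orth z hz⟩
    · simp only [LanczosState.step]
      rw [inner_matVec_comm hH, real_inner_self_eq_norm_sq, hs.unit h0, inner_smul_right]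
      -- `H q` differs from the residual by a vector orthogonal to the residual.
      have h1 := hs.inner_residual hH h0 hres
      rw [inner_sub_left, real_inner_self_eq_norm_sq, sub_eq_zero] at h1
      rw [h1]
      rcases eq_or_ne ‖s.residual (matVec H s.next)‖ 0 with h | h
      · simp [h]
      · field_simp

/-- The stored pairs `(z, H z)` range over the whole Krylov subspace, also for orders beyond a
breakdown. -/
theorem Invariant.ritzSpace_eq (hs : Invariant H b s) {j : ℕ}
    (hj : j ≤ s.pairs.length ∨ s.next = 0) :
    s.ritzSpace j = (krylov H b j).map (LinearMap.prod LinearMap.id (matLin H)) := by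
  have hspan : Submodule.span ℝ (Prod.fst '' {p | p ∈ s.pairs.take j}) = krylov H b j := by
    rcases Nat.le_total j s.pairs.length with h | h
    · exact hs.span_take j h
    · rcases hj with hj | hj
      · exact hs.span_take j hj
      · have hk : krylov H b (s.pairs.length + 1) = krylov H b s.pairs.length := by
          rw [hs.krylov_succ, hj]
          simp
        rw [krylov_eq_of_succ_eq hk h, ← hs.span_take _ le_rfl, List.take_of_length_le h,
          List.take_length]
  rw [← hspan, Submodule.map_span, ritzSpace, Set.image_image]
  congr 1
  ext p
  simp only [Set.mem_ofPred_eq, Set.mem_image, LinearMap.prod_apply]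
  constructor
  · intro hp
    exact ⟨p, hp, Prod.ext rfl (hs.pair p (List.mem_of_mem_take hp)).symm⟩
  · rintro ⟨q, hq, rfl⟩
    rwa [show Function.prod (⇑LinearMap.id) (⇑(matLin H)) q.1 = q from
      Prod.ext rfl (hs.pair q (List.mem_of_mem_take hq)).symm]

theorem Invariant.mem_ritzSpace (hs : Invariant H b s) {j : ℕ}
    (hj : j ≤ s.pairs.length ∨ s.next = 0) {p : Vec n × Vec n} :
    p ∈ s.ritzSpace j ↔ p.1 ∈ krylov H b j ∧ p.2 = matVec H p.1 := by
  rw [hs.ritzSpace_eq hj, Submodule.mem_map]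
  constructor
  · rintro ⟨z, hz, rfl⟩
    exact ⟨hz, rfl⟩
  · rintro ⟨h1, h2⟩
    exact ⟨p.1, h1, Prod.ext rfl h2.symm⟩

theorem Invariant.ritzValues_eq (hs : Invariant H b s) {j : ℕ}
    (hj : j ≤ s.pairs.length ∨ s.next = 0) :
    {x | ∃ p ∈ s.ritzSpace j, ‖p.1‖ = 1 ∧ x = ⟪p.1, p.2⟫} =
      {x | ∃ z ∈ krylov H b j, ‖z‖ = 1 ∧ x = ⟪z, matVec H z⟫} := by
  ext x
  simp only [hs.mem_ritzSpace hj, Set.mem_ofPred_eq]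
  constructor
  · rintro ⟨p, ⟨hz, hp⟩, h1, rfl⟩
    exact ⟨p.1, hz, h1, by rw [hp]⟩
  · rintro ⟨z, hz, h1, rfl⟩
    exact ⟨(z, matVec H z), ⟨hz, rfl⟩, h1, rfl⟩

theorem Invariant.ritzMin_eq (hs : Invariant H b s) {j : ℕ}
    (hj : j ≤ s.pairs.length ∨ s.next = 0) : s.ritzMin j = xiMin H b j := by
  rw [ritzMin, xiMin, hs.ritzValues_eq hj]

theorem Invariant.ritzMax_eq (hs : Invariant H b s) {j : ℕ}
    (hj : j ≤ s.pairs.length ∨ s.next = 0) : s.ritzMax j = xiMax H b j := by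
  rw [ritzMax, xiMax, hs.ritzValues_eq hj]

theorem Invariant.ritzVec_spec (hs : Invariant H b s) (hb : ‖b‖ = 1) {j : ℕ} (h1 : 1 ≤ j)
    (hj : j ≤ s.pairs.length ∨ s.next = 0) :
    ‖s.ritzVec j‖ = 1 ∧ ⟪s.ritzVec j, matVec H (s.ritzVec j)⟫ = xiMin H b j := by
  have hex : ∃ z : Vec n,
      ‖z‖ = 1 ∧ ∃ w : Vec n, (z, w) ∈ s.ritzSpace j ∧ ⟪z, w⟫ = s.ritzMin j := by
    obtain ⟨z, hz, hz1, e⟩ := exists_eq_xiMin (H := H) hb h1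
    exact ⟨z, hz1, matVec H z, (hs.mem_ritzSpace hj).mpr ⟨hz, rfl⟩,
      by rw [hs.ritzMin_eq hj, e]⟩
  obtain ⟨hn, w, hw, e⟩ := Classical.epsilon_spec hex
  refine ⟨hn, ?_⟩
  rw [show w = matVec H (s.ritzVec j) from ((hs.mem_ritzSpace hj).mp hw).2] at e
  exact e.trans (hs.ritzMin_eq hj)

end LanczosState

theorem MatVecProg.run_bind {n : ℕ} {α β : Type} (H : Matrix (Fin n) (Fin n) ℝ)
    (p : MatVecProg n α) (f : α → MatVecProg n β) :
    (p.bind f).run H =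
      (((f (p.run H).1).run H).1, (p.run H).2 + ((f (p.run H).1).run H).2) := by
  induction p with
  | done a => simp [MatVecProg.bind, MatVecProg.run]
  | query v next ih =>
    simp only [MatVecProg.bind, MatVecProg.run, ih]
    congr 1
    ring

theorem lanczosIterate_run {n : ℕ} {H : Matrix (Fin n) (Fin n) ℝ} (hH : H.IsSymm) {b : Vec n}
    (k : ℕ) {s : LanczosState n} (hs : s.Invariant H b) :
    (((lanczosIterate k s).run H).1).Invariant H b ∧ ((lanczosIterate k s).run H).2 ≤ k ∧
      (((lanczosIterate k s).run H).1.pairs.length = s.pairs.length + k ∨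
        ((lanczosIterate k s).run H).1.next = 0) ∧
      (s.next = 0 → ((lanczosIterate k s).run H).1.next = 0) := by
  induction k generalizing s with
  | zero => exact ⟨hs, le_rfl, Or.inl rfl, id⟩
  | succ k ih =>
    rw [lanczosIterate]
    split_ifs with h
    · exact ⟨hs, Nat.zero_le _, Or.inr h, id⟩
    · obtain ⟨h1, h2, h3, -⟩ := ih (hs.step hH h)
      refine ⟨h1, Nat.succ_le_succ h2, h3.imp_left fun e => ?_, fun h0 => absurd h0 h⟩
      rw [MatVecProg.run, e, LanczosState.step, List.length_append, List.length_singleton]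
      ring

theorem one_le_iterLimit {n : ℕ} (hn : 0 < n) (δ c : ℝ) : 1 ≤ iterLimit n δ c := by
  rw [iterLimit]
  split_ifs
  · exact hn
  · exact le_min hn (by omega)

/-- What the method computes, and how many products it asks for. -/
theorem adaptiveLanczos_run {n : ℕ} (hn : 0 < n) {H : Matrix (Fin n) (Fin n) ℝ} (hH : H.IsSymm)
    (ε δ : ℝ) {b : Vec n} (hb : ‖b‖ = 1) {out : LanczosOutput n}
    (hout : ((adaptiveLanczos ε δ b).run H).1 = out) :
    out.normEst = 2 * max |xiMax H b (jM n δ)| |xiMin H b (jM n δ)| ∧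
    out.eigEst = xiMin H b (jTotal n ε δ out.normEst) ∧
    (out.direction = none ↔ -ε / 2 < out.eigEst) ∧
    (∀ v, out.direction = some v → ‖v‖ = 1 ∧ ⟪v, matVec H v⟫ = out.eigEst) ∧
    ((adaptiveLanczos ε δ b).run H).2 ≤ max (jM n δ) (jTotal n ε δ out.normEst) := by
  obtain ⟨hs, hc, hlen, -⟩ :=
    lanczosIterate_run hH (jM n δ) (LanczosState.invariant_init (H := H) hb)
  rw [adaptiveLanczos, MatVecProg.run_bind, secondPhase, MatVecProg.run_bind] at hout ⊢
  set s := ((lanczosIterate (jM n δ) (LanczosState.init b)).run H).1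
  set M := normEstimate δ s with hM
  obtain ⟨hs', hc', hlen', hnext⟩ := lanczosIterate_run hH (jTotal n ε δ M - jM n δ) hs
  set s' := ((lanczosIterate (jTotal n ε δ M - jM n δ) s).run H).1
  simp only [MatVecProg.run, finish] at hout ⊢
  subst hout
  have hlen1 : jM n δ ≤ s.pairs.length ∨ s.next = 0 :=
    hlen.imp_left fun e => by simp [e, LanczosState.init]
  have hlen2 : jTotal n ε δ M ≤ s'.pairs.length ∨ s'.next = 0 := by
    rcases hlen1 with h1 | h1
    · exact hlen'.imp_left fun e => by omega
    · exact Or.inr (hnext h1)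
  have hmin := hs'.ritzMin_eq hlen2
  refine ⟨?_, hmin, ?_, ?_, by simp only; omega⟩
  · simp only [hM, normEstimate, hs.ritzMin_eq hlen1, hs.ritzMax_eq hlen1]
  · simp
  · intro v hv
    simp only at hv ⊢
    split_ifs at hv
    obtain rfl := Option.some.inj hv
    rw [hmin]
    exact hs'.ritzVec_spec hb (one_le_iterLimit hn _ _) hlen2

/-! ### A weighted Chebyshev polynomial -/

/-- The Chebyshev polynomials of the fourth kind, with
`sin φ * W k (cos (2 φ)) = sin ((2 k + 1) φ)`. -/
noncomputable def chebyshevW : ℕ → Polynomial ℝ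
  | 0 => 1
  | 1 => 2 * Polynomial.X + 1
  | k + 2 => 2 * Polynomial.X * chebyshevW (k + 1) - chebyshevW k

open Polynomial in
theorem natDegree_chebyshevW_le (k : ℕ) : (chebyshevW k).natDegree ≤ k := by
  have h2 : (2 * X : ℝ[X]).natDegree ≤ 1 := by
    rw [show (2 : ℝ[X]) = C 2 from rfl]
    exact natDegree_C_mul_le 2 X |>.trans natDegree_X_le
  induction k using Nat.twoStepInduction with
  | zero => simp [chebyshevW]
  | one =>
    rw [chebyshevW]
    exact natDegree_add_le_of_degree_le h2 (by simp)
  | more k h0 h1 =>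
    rw [chebyshevW]
    refine natDegree_sub_le_of_le (m := k + 2) ?_ (by omega) |>.trans (by simp)
    exact natDegree_mul_le.trans (by omega)

theorem sin_mul_chebyshevW (φ : ℝ) (k : ℕ) :
    Real.sin φ * (chebyshevW k).eval (Real.cos (2 * φ)) = Real.sin ((2 * k + 1) * φ) := by
  induction k using Nat.twoStepInduction with
  | zero => simp [chebyshevW]
  | one =>
    have : (2 * ((1 : ℕ) : ℝ) + 1) * φ = 2 * φ + φ := by push_cast; ring
    rw [this, Real.sin_add, Real.sin_two_mul, Real.cos_two_mul]
    simp only [chebyshevW, Polynomial.eval_add, Polynomial.eval_mul, Polynomial.eval_ofNat,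
      Polynomial.eval_X, Polynomial.eval_one]
    ring
  | more k h0 h1 =>
    have e2 : (2 * ((k + 2 : ℕ) : ℝ) + 1) * φ = (2 * ((k + 1 : ℕ) : ℝ) + 1) * φ + 2 * φ := by
      push_cast; ring
    have e0 : (2 * (k : ℝ) + 1) * φ = (2 * ((k + 1 : ℕ) : ℝ) + 1) * φ - 2 * φ := by
      push_cast; ring
    rw [e0, Real.sin_sub] at h0
    rw [e2, Real.sin_add]
    simp only [chebyshevW, Polynomial.eval_sub, Polynomial.eval_mul, Polynomial.eval_ofNat,
      Polynomial.eval_X]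
    linear_combination 2 * Real.cos (2 * φ) * h1 - h0

theorem sinh_mul_chebyshevW (s : ℝ) (k : ℕ) :
    Real.sinh s * (chebyshevW k).eval (Real.cosh (2 * s)) = Real.sinh ((2 * k + 1) * s) := by
  induction k using Nat.twoStepInduction with
  | zero => simp [chebyshevW]
  | one =>
    have : (2 * ((1 : ℕ) : ℝ) + 1) * s = 2 * s + s := by push_cast; ring
    rw [this, Real.sinh_add, Real.sinh_two_mul, Real.cosh_two_mul, Real.cosh_sq]
    simp only [chebyshevW, Polynomial.eval_add, Polynomial.eval_mul, Polynomial.eval_ofNat,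
      Polynomial.eval_X, Polynomial.eval_one]
    linear_combination -2 * Real.sinh s * Real.cosh_sq s
  | more k h0 h1 =>
    have e2 : (2 * ((k + 2 : ℕ) : ℝ) + 1) * s = (2 * ((k + 1 : ℕ) : ℝ) + 1) * s + 2 * s := by
      push_cast; ring
    have e0 : (2 * (k : ℝ) + 1) * s = (2 * ((k + 1 : ℕ) : ℝ) + 1) * s - 2 * s := by
      push_cast; ring
    rw [e0, Real.sinh_sub] at h0
    rw [e2, Real.sinh_add]
    simp only [chebyshevW, Polynomial.eval_sub, Polynomial.eval_mul, Polynomial.eval_ofNat,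
      Polynomial.eval_X]
    linear_combination 2 * Real.cosh (2 * s) * h1 - h0

theorem le_artanh {x : ℝ} (h0 : 0 ≤ x) (h1 : x < 1) : x ≤ Real.artanh x := by
  rw [Real.artanh_eq_half_log ⟨by linarith, h1.le⟩, Real.log_div (by linarith) (by linarith)]
  have h := Real.hasSum_log_sub_log_of_abs_lt_one (abs_lt.mpr ⟨by linarith, h1⟩)
  have := le_hasSum h 0 (fun k _ => by positivity)
  norm_num at this
  linarith

/-- A polynomial that is small on `[μ + θ, μ + R]`, with the weight `x - (μ + θ)`, and large
at `μ`. -/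
theorem exists_polynomial_weighted_bound (k : ℕ) {μ θ R : ℝ} (hθ : 0 < θ) (hR : θ < R) :
    ∃ p : Polynomial ℝ, p.natDegree ≤ k ∧
      (∀ x, μ ≤ x → x ≤ μ + R → p.eval x ^ 2 * (x - (μ + θ)) ≤ R - θ) ∧
      (R - θ) * (Real.cosh ((2 * k + 1) * √(θ / R)) ^ 2 - 1) ≤ p.eval μ ^ 2 * θ := by
  have hD : 0 < R - θ := sub_pos.mpr hR
  have hR0 : 0 < R := hθ.trans hR
  refine ⟨(chebyshevW k).comp (Polynomial.C (-2 / (R - θ)) * Polynomial.X +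
    Polynomial.C (1 + 2 * (μ + θ) / (R - θ))), ?_, ?_, ?_⟩
  · refine Polynomial.natDegree_comp_le.trans ?_
    calc _ ≤ k * 1 := Nat.mul_le_mul (natDegree_chebyshevW_le k) Polynomial.natDegree_linear_le
      _ = k := mul_one k
  · intro x hx hx'
    rw [Polynomial.eval_comp]
    simp only [Polynomial.eval_add, Polynomial.eval_mul, Polynomial.eval_C, Polynomial.eval_X]
    rcases le_total x (μ + θ) with h | h
    · nlinarith [mul_nonneg (sq_nonneg ((chebyshevW k).eval
        (-2 / (R - θ) * x + (1 + 2 * (μ + θ) / (R - θ))))) (sub_nonneg.mpr h)]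
    · -- The weight is `(R - θ) * sin φ ^ 2` where the argument of `W` is `cos (2 φ)`.
      set c : ℝ := √((x - (μ + θ)) / (R - θ)) with hc
      have hc2 : c ^ 2 = (x - (μ + θ)) / (R - θ) :=
        Real.sq_sqrt (div_nonneg (sub_nonneg.mpr h) hD.le)
      have hc1 : c ≤ 1 := Real.sqrt_le_one.mpr ((div_le_one hD).mpr (by linarith))
      have hsin : Real.sin (Real.arcsin c) = c :=
        Real.sin_arcsin (by linarith [Real.sqrt_nonneg ((x - (μ + θ)) / (R - θ))]) hc1
      have hcos : Real.cos (2 * Real.arcsin c) =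
          -2 / (R - θ) * x + (1 + 2 * (μ + θ) / (R - θ)) := by
        rw [Real.cos_two_mul, Real.cos_sq', hsin, hc2]
        ring
      have hW := sin_mul_chebyshevW (Real.arcsin c) k
      rw [hsin, hcos] at hW
      have hx2 : x - (μ + θ) = c ^ 2 * (R - θ) := by rw [hc2]; field_simp
      rw [hx2]
      have h1 := Real.sin_sq_le_one ((2 * k + 1) * Real.arcsin c)
      rw [← hW] at h1
      nlinarith
  · rw [Polynomial.eval_comp]
    simp only [Polynomial.eval_add, Polynomial.eval_mul, Polynomial.eval_C, Polynomial.eval_X]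
    set t := √(θ / R) with ht
    have ht2 : t ^ 2 = θ / R := Real.sq_sqrt (by positivity)
    have ht0 : 0 ≤ t := Real.sqrt_nonneg _
    have ht1 : t < 1 := by
      rw [ht, Real.sqrt_lt' one_pos, one_pow, div_lt_one hR0]
      exact hR
    have hsinh : Real.sinh (Real.artanh t) ^ 2 = θ / (R - θ) := by
      rw [Real.sinh_artanh ⟨by linarith, ht1⟩, div_pow, ht2,
        Real.sq_sqrt (sub_nonneg.mpr ((div_le_one hR0).mpr hR.le))]
      field_simp
    have hcosh : Real.cosh (2 * Real.artanh t) =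
        -2 / (R - θ) * μ + (1 + 2 * (μ + θ) / (R - θ)) := by
      rw [Real.cosh_two_mul, Real.cosh_sq, hsinh]
      field_simp
      ring
    have hW := sinh_mul_chebyshevW (Real.artanh t) k
    rw [hcosh] at hW
    have hmono : Real.cosh ((2 * k + 1) * t) ≤ Real.cosh ((2 * k + 1) * Real.artanh t) := by
      rw [Real.cosh_le_cosh, abs_of_nonneg (by positivity),
        abs_of_nonneg (mul_nonneg (by positivity) (Real.artanh_nonneg ht0))]
      exact mul_le_mul_of_nonneg_left (le_artanh ht0 ht1) (by positivity)
    have hθ' : θ = (R - θ) * Real.sinh (Real.artanh t) ^ 2 := by rw [hsinh]; field_simp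
    calc (R - θ) * (Real.cosh ((2 * k + 1) * t) ^ 2 - 1)
        ≤ (R - θ) * (Real.cosh ((2 * k + 1) * Real.artanh t) ^ 2 - 1) := by
          have := Real.cosh_pos ((2 * k + 1) * t)
          gcongr
      _ = (R - θ) * Real.sinh ((2 * k + 1) * Real.artanh t) ^ 2 := by
          rw [Real.cosh_sq]
          ring
      _ = _ := by
          rw [← hW]
          linear_combination -((chebyshevW k).eval
            (-2 / (R - θ) * μ + (1 + 2 * (μ + θ) / (R - θ)))) ^ 2 * hθ'

/-! ### Ritz values of a starting vector with a component along an extreme eigenvector -/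

section RitzBound

variable {n : ℕ} {H : Matrix (Fin n) (Fin n) ℝ} {b : Vec n}
  {e : OrthonormalBasis (Fin n) ℝ (Vec n)} {lam : Fin n → ℝ}

theorem inner_eigenvector_matVec (hH : H.IsSymm) (he : ∀ i, matVec H (e i) = lam i • e i)
    (i : Fin n) (v : Vec n) : ⟪e i, matVec H v⟫ = lam i * ⟪e i, v⟫ := by
  rw [inner_matVec_comm hH, he, real_inner_smul_left]

theorem inner_eigenvector_aeval (hH : H.IsSymm) (he : ∀ i, matVec H (e i) = lam i • e i)
    (i : Fin n) (p : Polynomial ℝ) (v : Vec n) :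
    ⟪e i, Polynomial.aeval (matLin H) p v⟫ = p.eval (lam i) * ⟪e i, v⟫ := by
  induction p using Polynomial.induction_on' generalizing v with
  | add p q hp hq => simp [inner_add_right, hp, hq, add_mul]
  | monomial k c =>
    rw [Polynomial.aeval_monomial, Polynomial.eval_monomial]
    induction k generalizing v with
    | zero => simp [inner_smul_right, Algebra.algebraMap_eq_smul_one]
    | succ k ih =>
      rw [pow_succ, ← mul_assoc, Module.End.mul_apply, ih, matLin_apply,
        inner_eigenvector_matVec hH he]
      ring

theorem aeval_mem_krylov {p : Polynomial ℝ} {j : ℕ} (hp : p.natDegree < j) :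
    Polynomial.aeval (matLin H) p b ∈ krylov H b j := by
  rw [Polynomial.aeval_eq_sum_range, LinearMap.sum_apply]
  refine Submodule.sum_mem _ fun i hi => Submodule.smul_mem _ _ ?_
  rw [Module.End.pow_apply]
  exact iterate_mem_krylov (H := H) (by have := Finset.mem_range.mp hi; omega)

/-- A polynomial test vector bounds the smallest Ritz value. -/
theorem xiMin_le_of_polynomial (hH : H.IsSymm) (he : ∀ i, matVec H (e i) = lam i • e i)
    {p : Polynomial ℝ} {j : ℕ} (hp : p.natDegree < j) {c : ℝ}
    (hsum : ∑ i, (p.eval (lam i) * ⟪e i, b⟫) ^ 2 * (lam i - c) ≤ 0)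
    (hne : ∃ i, p.eval (lam i) * ⟪e i, b⟫ ≠ 0) : xiMin H b j ≤ c := by
  set w := Polynomial.aeval (matLin H) p b with hw
  have hwi : ∀ i, ⟪e i, w⟫ = p.eval (lam i) * ⟪e i, b⟫ := fun i =>
    inner_eigenvector_aeval hH he i p b
  have hw0 : w ≠ 0 := by
    rintro h0
    obtain ⟨i, hi⟩ := hne
    rw [← hwi, h0, inner_zero_right] at hi
    exact hi rfl
  have hnorm : ‖w‖ ≠ 0 := norm_ne_zero_iff.mpr hw0
  have hle : ⟪w, matVec H w⟫ ≤ c * ‖w‖ ^ 2 := by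
    rw [← e.sum_sq_inner_right w, ← e.sum_inner_mul_inner, Finset.mul_sum, ← sub_nonpos,
      ← Finset.sum_sub_distrib]
    convert hsum using 2 with i
    rw [inner_eigenvector_matVec hH he, real_inner_comm, hwi]
    ring
  refine (xiMin_le_inner (z := ‖w‖⁻¹ • w) (Submodule.smul_mem _ _ (aeval_mem_krylov hp))
    (by rw [norm_smul, norm_inv, norm_norm, inv_mul_cancel₀ hnorm])).trans ?_
  rw [matVec_smul, real_inner_smul_left, inner_smul_right]
  have : 0 < ‖w‖ := norm_pos_iff.mpr hw0
  field_simp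
  linarith

/-- After `n` iterations the smallest Ritz value is exact. -/
theorem xiMin_dim_le (hH : H.IsSymm) (he : ∀ i, matVec H (e i) = lam i • e i)
    {i₀ : Fin n} (hb : ⟪e i₀, b⟫ ≠ 0) : xiMin H b n ≤ lam i₀ := by
  classical
  have heval : ∀ x, (∏ y ∈ (Finset.univ.image lam).erase (lam i₀),
      (Polynomial.X - Polynomial.C y)).eval x =
        ∏ y ∈ (Finset.univ.image lam).erase (lam i₀), (x - y) := by
    intro x
    simp [Polynomial.eval_prod]
  refine xiMin_le_of_polynomial hH he
    (p := ∏ y ∈ (Finset.univ.image lam).erase (lam i₀), (Polynomial.X - Polynomial.C y)) ?_ ?_ ?_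
  · rw [Polynomial.natDegree_prod_of_monic _ _ fun y _ => Polynomial.monic_X_sub_C y]
    simp only [Polynomial.natDegree_X_sub_C, Finset.sum_const, smul_eq_mul, mul_one]
    refine (Finset.card_erase_lt_of_mem (by simp)).trans_le ?_
    simpa using Finset.card_image_le (s := Finset.univ) (f := lam)
  · refine (Finset.sum_eq_zero fun i _ => ?_).le
    rw [heval]
    by_cases h : lam i = lam i₀
    · simp [h]
    · rw [Finset.prod_eq_zero (i := lam i) (by simp [h]) (sub_self _)]
      simp
  · refine ⟨i₀, mul_ne_zero ?_ hb⟩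
    rw [heval]
    exact Finset.prod_ne_zero_iff.mpr fun y hy => sub_ne_zero.mpr (Finset.ne_of_mem_erase hy).symm

/-- The Kuczyński–Woźniakowski estimate for a fixed starting vector. -/
theorem xiMin_succ_le (hH : H.IsSymm) (he : ∀ i, matVec H (e i) = lam i • e i) {i₀ : Fin n}
    {θ R : ℝ} (hmin : ∀ i, lam i₀ ≤ lam i) (hmax : ∀ i, lam i ≤ lam i₀ + R) (hθ : 0 < θ)
    (hb : ‖b‖ = 1) (hb0 : ⟪e i₀, b⟫ ≠ 0) (k : ℕ)
    (hk : 1 ≤ |⟪e i₀, b⟫| * Real.cosh ((2 * k + 1) * √(θ / R))) :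
    xiMin H b (k + 1) ≤ lam i₀ + θ := by
  rcases le_or_gt R θ with hR | hR
  · refine xiMin_le_of_polynomial hH he (p := 1) (by simp) ?_ ⟨i₀, by simpa using hb0⟩
    exact Finset.sum_nonpos fun i _ =>
      mul_nonpos_of_nonneg_of_nonpos (sq_nonneg _) (by linarith [hmax i])
  · obtain ⟨p, hdeg, hle, hge⟩ := exists_polynomial_weighted_bound k (μ := lam i₀) hθ hR
    have hD : 0 < R - θ := sub_pos.mpr hR
    set C := Real.cosh ((2 * k + 1) * √(θ / R)) with hC
    have hC1 : 1 < C := by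
      rw [hC, Real.one_lt_cosh]
      have : 0 < √(θ / R) := Real.sqrt_pos.mpr (div_pos hθ (hθ.trans hR))
      positivity
    have hk2 : 1 ≤ ⟪e i₀, b⟫ ^ 2 * C ^ 2 := by
      rw [← sq_abs, ← mul_pow]
      exact one_le_pow₀ hk
    refine xiMin_le_of_polynomial hH he (Nat.lt_succ_of_le hdeg) ?_ ⟨i₀, mul_ne_zero ?_ hb0⟩
    · have hother : ∀ i ∈ Finset.univ.erase i₀,
          (p.eval (lam i) * ⟪e i, b⟫) ^ 2 * (lam i - (lam i₀ + θ)) ≤ ⟪e i, b⟫ ^ 2 * (R - θ) := by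
        intro i _
        have := mul_le_mul_of_nonneg_left (hle (lam i) (hmin i) (hmax i)) (sq_nonneg ⟪e i, b⟫)
        calc _ = _ := by ring
          _ ≤ _ := this
      have hone : ⟪e i₀, b⟫ ^ 2 + ∑ i ∈ Finset.univ.erase i₀, ⟪e i, b⟫ ^ 2 = 1 := by
        rw [Finset.add_sum_erase _ (fun i => ⟪e i, b⟫ ^ 2) (Finset.mem_univ i₀),
          e.sum_sq_inner_right, hb, one_pow]
      rw [← Finset.add_sum_erase _ _ (Finset.mem_univ i₀)]
      have h1 := Finset.sum_le_sum hother
      rw [← Finset.sum_mul] at h1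
      have h2 := mul_le_mul_of_nonneg_left hge (sq_nonneg ⟪e i₀, b⟫)
      have h3 : ∑ i ∈ Finset.univ.erase i₀, ⟪e i, b⟫ ^ 2 = 1 - ⟪e i₀, b⟫ ^ 2 := by linarith
      rw [h3] at h1
      have h4 := mul_nonneg hD.le (sub_nonneg.mpr hk2)
      nlinarith
    · intro h0
      rw [h0] at hge
      have : 0 < (R - θ) * (C ^ 2 - 1) := mul_pos hD (by nlinarith)
      linarith [this, hge]

/-- If the component of the starting vector along an eigenvector for the smallest eigenvalue
exceeds `2 δ / (5 √n)`, then the smallest Ritz value at the iteration limit with factor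
`c ≥ √(R / θ) / 2` is accurate up to `θ`, also where the limit is cut off at `n`. -/
theorem xiMin_iterLimit_le (hH : H.IsSymm) (he : ∀ i, matVec H (e i) = lam i • e i)
    {i₀ : Fin n} {θ R c δ : ℝ} (hmin : ∀ i, lam i₀ ≤ lam i) (hmax : ∀ i, lam i ≤ lam i₀ + R)
    (hθ : 0 < θ) (hc : 1 / 2 ≤ c * √(θ / R)) (hδ0 : 0 ≤ δ) (hb : ‖b‖ = 1)
    (hb0 : 2 * δ / (5 * √n) < |⟪e i₀, b⟫|) :
    xiMin H b (iterLimit n δ c) ≤ lam i₀ + θ := by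
  have hne : ⟪e i₀, b⟫ ≠ 0 := abs_pos.mp (lt_of_le_of_lt (by positivity) hb0)
  have hn := (xiMin_dim_le hH he hne).trans (le_add_of_nonneg_right hθ.le)
  rw [iterLimit]
  split_ifs with hδ
  · exact hn
  have hδ' : 0 < δ := lt_of_le_of_ne hδ0 (Ne.symm hδ)
  rcases min_choice n (1 + ⌈1 / 2 * Real.log (25 * n / δ ^ 2) * c⌉₊) with h | h <;> rw [h]
  · exact hn
  rw [add_comm]
  set k := ⌈1 / 2 * Real.log (25 * n / δ ^ 2) * c⌉₊ with hk
  refine xiMin_succ_le hH he hmin hmax hθ hb hne k ?_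
  have hn0 : (0 : ℝ) < n := Nat.cast_pos.mpr i₀.pos
  have hlog : Real.log (25 * n / δ ^ 2) / 2 = Real.log (5 * √n / δ) := by
    rw [← Real.log_sqrt (by positivity), Real.sqrt_div' _ (sq_nonneg δ), Real.sqrt_sq hδ0,
      Real.sqrt_mul (by norm_num), show √(25 : ℝ) = 5 by
        rw [show (25 : ℝ) = 5 ^ 2 by norm_num, Real.sqrt_sq (by norm_num)]]
  have hkL := Nat.le_ceil (1 / 2 * Real.log (25 * n / δ ^ 2) * c)
  rw [← hk] at hkL
  -- `2 k √(θ / R)` is at least half of the logarithm, because `k` carries the factor `c`.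
  have hexp : 5 * √n / δ ≤ Real.exp ((2 * k + 1) * √(θ / R)) := by
    rw [← Real.log_le_iff_le_exp (by positivity), ← hlog]
    have ht := Real.sqrt_nonneg (θ / R)
    have hk1 := mul_le_mul_of_nonneg_right hkL ht
    rcases le_total 0 (Real.log (25 * n / δ ^ 2)) with hL | hL
    · nlinarith [mul_le_mul_of_nonneg_left hc hL]
    · have : 0 ≤ (2 * (k : ℝ) + 1) * √(θ / R) := by positivity
      linarith
  have hcosh : 5 * √n / δ / 2 ≤ Real.cosh ((2 * k + 1) * √(θ / R)) := by
    rw [Real.cosh_eq]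
    have := Real.exp_pos (-((2 * k + 1) * √(θ / R)))
    linarith
  calc (1 : ℝ) = 2 * δ / (5 * √n) * (5 * √n / δ / 2) := by field_simp
    _ ≤ _ := mul_le_mul hb0.le hcosh (by positivity) (abs_nonneg _)

end RitzBound

/-! ### Small components of a uniformly distributed unit vector -/

theorem volume_unitBall (m : ℕ) : volume (Metric.ball (0 : Vec m) 1) =
    ENNReal.ofReal (√Real.pi ^ m / Real.Gamma (m / 2 + 1)) := by
  rcases Nat.eq_zero_or_pos m with rfl | hm
  · rw [volume_euclideanSpace_eq_dirac]
    simp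
  · have : Nonempty (Fin m) := ⟨⟨0, hm⟩⟩
    rw [EuclideanSpace.volume_ball]
    simp

/-- Log-convexity of the Gamma function bounds the growth from one half-integer to the next. -/
theorem Gamma_half_succ_le (m : ℕ) : Real.Gamma ((m + 1 : ℕ) / 2 + 1) ≤
    5 / 8 * √(m + 1 : ℕ) * √Real.pi * Real.Gamma (m / 2 + 1) := by
  have hs : (0 : ℝ) < m / 2 + 1 := by positivity
  have hG := Real.Gamma_pos_of_pos hs
  have h := Real.Gamma_mul_add_mul_le_rpow_Gamma_mul_rpow_Gamma hs (add_pos hs one_pos)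
    one_half_pos one_half_pos (add_halves (1 : ℝ))
  rw [← Real.sqrt_eq_rpow, ← Real.sqrt_eq_rpow, Real.Gamma_add_one hs.ne', Real.sqrt_mul hs.le,
    mul_left_comm, Real.mul_self_sqrt hG.le] at h
  have e : (1 : ℝ) / 2 * (m / 2 + 1) + 1 / 2 * (m / 2 + 1 + 1) = (m + 1 : ℕ) / 2 + 1 := by
    push_cast; ring
  rw [e] at h
  refine h.trans (mul_le_mul_of_nonneg_right ?_ hG.le)
  rw [Real.sqrt_le_left (by positivity), mul_pow, mul_pow, Real.sq_sqrt (by positivity),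
    Real.sq_sqrt Real.pi_pos.le]
  push_cast
  have hm : (0 : ℝ) ≤ m := Nat.cast_nonneg m
  nlinarith [mul_le_mul_of_nonneg_right Real.pi_gt_three.le (by positivity : (0 : ℝ) ≤ m + 1)]

theorem volume_unitBall_le (m : ℕ) : volume (Metric.ball (0 : Vec m) 1) ≤
    ENNReal.ofReal (5 / 8 * √(m + 1 : ℕ)) * volume (Metric.ball (0 : Vec (m + 1)) 1) := by
  rw [volume_unitBall, volume_unitBall, ← ENNReal.ofReal_mul (by positivity)]
  apply ENNReal.ofReal_le_ofReal
  have h1 : 0 < Real.Gamma (m / 2 + 1) := Real.Gamma_pos_of_pos (by positivity)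
  have h2 : 0 < Real.Gamma ((m + 1 : ℕ) / 2 + 1) := Real.Gamma_pos_of_pos (by positivity)
  rw [← mul_div_assoc, div_le_div_iff₀ h1 h2]
  calc √Real.pi ^ m * Real.Gamma ((m + 1 : ℕ) / 2 + 1)
      ≤ √Real.pi ^ m * (5 / 8 * √(m + 1 : ℕ) * √Real.pi * Real.Gamma (m / 2 + 1)) :=
        mul_le_mul_of_nonneg_left (Gamma_half_succ_le m) (by positivity)
    _ = _ := by ring

/-- The part of the unit ball in a slab lies in the product of an interval and a unit ball of one
dimension less. -/
theorem volume_ball_inter_slab_le {m : ℕ} (i : Fin (m + 1)) (t : ℝ) :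
    volume {x : Vec (m + 1) | ‖x‖ < 1 ∧ |x i| ≤ t} ≤
      ENNReal.ofReal (2 * t) * volume (Metric.ball (0 : Vec m) 1) := by
  have hφ := ((MeasurePreserving.id (volume : Measure ℝ)).prod
    (PiLp.volume_preserving_toLp (Fin m))).comp
      ((volume_preserving_piFinSuccAbove (fun _ => ℝ) i).comp
        (PiLp.volume_preserving_ofLp (Fin (m + 1))))
  have hmeas : MeasurableSet (Set.Icc (-t) t ×ˢ Metric.ball (0 : Vec m) 1) :=
    measurableSet_Icc.prod measurableSet_ball
  calc _ ≤ _ := measure_mono ?_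
    _ = _ := hφ.measure_preimage hmeas.nullMeasurableSet
    _ = _ := by
      rw [Measure.prod_prod, Real.volume_Icc]
      ring_nf
  rintro x ⟨hx, hxi⟩
  refine ⟨abs_le.mp hxi, ?_⟩
  rw [mem_ball_zero_iff, ← sq_lt_one_iff₀ (norm_nonneg _)]
  rw [← sq_lt_one_iff₀ (norm_nonneg _), EuclideanSpace.norm_sq_eq, Fin.sum_univ_succAbove _ i] at hx
  rw [EuclideanSpace.norm_sq_eq]
  refine lt_of_le_of_lt ?_ hx
  exact le_add_of_nonneg_left (sq_nonneg _)

theorem uniformSphere_univ {n : ℕ} (hn : 0 < n) : uniformSphere n Set.univ = 1 := by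
  have : Nonempty (Fin n) := ⟨⟨0, hn⟩⟩
  rw [uniformSphere, Measure.smul_apply, smul_eq_mul]
  apply ENNReal.inv_mul_cancel
  · rw [Measure.toSphere_apply_univ]
    refine mul_ne_zero (by simpa using hn.ne') (Metric.measure_ball_pos _ _ one_pos).ne'
  · exact measure_ne_top _ _

theorem measurableSet_abs_inner_le {n : ℕ} (u : Vec n) (t : ℝ) :
    MeasurableSet {b : Metric.sphere (0 : Vec n) 1 | |⟪u, (b : Vec n)⟫| ≤ t} :=
  (isClosed_le (by fun_prop) continuous_const).measurableSet

open Pointwise in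
/-- A uniformly distributed unit vector has a component of size at most `t` with probability at
most `5 / 4 * t * √n`: by the definition of the surface measure as a cone measure, it suffices to
bound the volume of the slab of width `2 t` in the unit ball. -/
theorem uniformSphere_abs_inner_le {n : ℕ} (e : OrthonormalBasis (Fin n) ℝ (Vec n)) (i : Fin n)
    {t : ℝ} (ht : 0 ≤ t) :
    uniformSphere n {b | |⟪e i, (b : Vec n)⟫| ≤ t} ≤ ENNReal.ofReal (5 / 4 * t * √n) := by
  obtain ⟨m, rfl⟩ : ∃ m, n = m + 1 := ⟨n - 1, by have := i.pos; omega⟩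
  set V := volume (Metric.ball (0 : Vec (m + 1)) 1) with hV
  have hcone : volume (Set.Ioo (0 : ℝ) 1 • ((↑) '' {b : Metric.sphere (0 : Vec (m + 1)) 1 |
      |⟪e i, (b : Vec (m + 1))⟫| ≤ t} : Set (Vec (m + 1)))) ≤
      ENNReal.ofReal (5 / 4 * t * √(m + 1 : ℕ)) * V := by
    have hslab : MeasurableSet {x : Vec (m + 1) | ‖x‖ < 1 ∧ |x i| ≤ t} :=
      (isOpen_lt continuous_norm continuous_const).measurableSet.inter
        (isClosed_le (by fun_prop : Continuous fun x : Vec (m + 1) => |x i|)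
          continuous_const).measurableSet
    calc _ ≤ volume (e.repr ⁻¹' {x : Vec (m + 1) | ‖x‖ < 1 ∧ |x i| ≤ t}) := measure_mono ?_
      _ = volume {x : Vec (m + 1) | ‖x‖ < 1 ∧ |x i| ≤ t} :=
        e.measurePreserving_repr.measure_preimage hslab.nullMeasurableSet
      _ ≤ ENNReal.ofReal (2 * t) * volume (Metric.ball (0 : Vec m) 1) :=
        volume_ball_inter_slab_le i t
      _ ≤ ENNReal.ofReal (2 * t) * (ENNReal.ofReal (5 / 8 * √(m + 1 : ℕ)) * V) := by
        gcongr
        exact volume_unitBall_le m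
      _ = _ := by
        rw [← mul_assoc, ← ENNReal.ofReal_mul (by positivity)]
        ring_nf
    rintro _ ⟨r, ⟨hr0, hr1⟩, _, ⟨b, hb, rfl⟩, rfl⟩
    have hb1 : ‖(b : Vec (m + 1))‖ = 1 := mem_sphere_zero_iff_norm.mp b.2
    have hb' : |⟪e i, (b : Vec (m + 1))⟫| ≤ t := hb
    refine ⟨?_, ?_⟩
    · simpa [norm_smul, hb1, abs_of_pos hr0] using hr1
    · simp only [map_smul, PiLp.smul_apply, OrthonormalBasis.repr_apply_apply, smul_eq_mul,
        abs_mul, abs_of_pos hr0]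
      nlinarith [abs_nonneg ⟪e i, (b : Vec (m + 1))⟫]
  have hfin : ((Module.finrank ℝ (Vec (m + 1)) : ℕ) : ENNReal) * V ≠ ⊤ :=
    ENNReal.mul_ne_top (ENNReal.natCast_ne_top _) measure_ball_lt_top.ne
  have hpos : ((Module.finrank ℝ (Vec (m + 1)) : ℕ) : ENNReal) * V ≠ 0 :=
    mul_ne_zero (by simp) (Metric.measure_ball_pos _ _ one_pos).ne'
  rw [uniformSphere, Measure.smul_apply, smul_eq_mul, Measure.toSphere_apply_univ,
    Measure.toSphere_apply' _ (measurableSet_abs_inner_le _ _), ← hV, mul_comm,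
    ← div_eq_mul_inv]
  refine ENNReal.div_le_of_le_mul ?_
  calc _ ≤ _ := mul_le_mul_right hcone _
    _ = _ := by ring

/-- Two components of a uniformly distributed unit vector both exceed `2 δ / (5 √n)` with
probability at least `1 - δ`. -/
theorem le_uniformSphere_lt_abs_inner {n : ℕ} (e : OrthonormalBasis (Fin n) ℝ (Vec n))
    (i j : Fin n) {δ : ℝ} (hδ : 0 ≤ δ) :
    ENNReal.ofReal (1 - δ) ≤ uniformSphere n
      ({b | |⟪e i, (b : Vec n)⟫| ≤ 2 * δ / (5 * √n)} ∪
        {b | |⟪e j, (b : Vec n)⟫| ≤ 2 * δ / (5 * √n)})ᶜ := by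
  have hn : (0 : ℝ) < n := Nat.cast_pos.mpr i.pos
  set B : Fin n → Set (Metric.sphere (0 : Vec n) 1) :=
    fun i => {b | |⟪e i, (b : Vec n)⟫| ≤ 2 * δ / (5 * √n)} with hB
  have hbound : ∀ i, uniformSphere n (B i) ≤ ENNReal.ofReal (δ / 2) := by
    intro i
    refine (uniformSphere_abs_inner_le e i (by positivity)).trans_eq ?_
    congr 1
    have := Real.sqrt_pos.mpr hn
    field_simp
    norm_num
  rw [ENNReal.ofReal_sub _ hδ, ENNReal.ofReal_one, tsub_le_iff_right, ← uniformSphere_univ i.pos]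
  calc _ = uniformSphere n ((B i ∪ B j)ᶜ ∪ (B i ∪ B j)) := by rw [Set.compl_union_self]
    _ ≤ uniformSphere n (B i ∪ B j)ᶜ + (uniformSphere n (B i) + uniformSphere n (B j)) :=
      (measure_union_le _ _).trans (add_le_add_right (measure_union_le _ _) _)
    _ ≤ uniformSphere n (B i ∪ B j)ᶜ + (ENNReal.ofReal (δ / 2) + ENNReal.ofReal (δ / 2)) := by
      gcongr <;> exact hbound _
    _ = _ := by rw [← ENNReal.ofReal_add (by positivity) (by positivity), add_halves]

/-! ### Eigenvalues, the spectral norm and the norm estimate -/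

section Norm

variable {n : ℕ} {H : Matrix (Fin n) (Fin n) ℝ} {b : Vec n}
  {e : OrthonormalBasis (Fin n) ℝ (Vec n)} {lam : Fin n → ℝ}

/-- A symmetric matrix has an orthonormal eigenbasis, and the eigenvalues over which `lambdaMin` is
an infimum are those of the basis. -/
theorem exists_eigenbasis (hH : H.IsSymm) :
    ∃ (e : OrthonormalBasis (Fin n) ℝ (Vec n)) (lam : Fin n → ℝ),
      (∀ i, matVec H (e i) = lam i • e i) ∧
      {μ : ℝ | Module.End.HasEigenvalue (Matrix.toLin' H) μ} = Set.range lam := by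
  have hH' : H.IsHermitian := by
    rw [Matrix.IsHermitian, Matrix.conjTranspose_eq_transpose_of_trivial]
    exact hH
  refine ⟨hH'.eigenvectorBasis, hH'.eigenvalues, fun i => ?_, ?_⟩
  · apply WithLp.ofLp_injective
    exact hH'.mulVec_eigenvectorBasis i
  · ext μ
    rw [← hH'.spectrum_real_eq_range_eigenvalues, Set.mem_ofPred_eq,
      Module.End.hasEigenvalue_iff_mem_spectrum, Matrix.spectrum_toLin']

theorem abs_eigenvalue_le_specNorm (he : ∀ i, matVec H (e i) = lam i • e i) (i : Fin n) :
    |lam i| ≤ specNorm H := by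
  have := abs_inner_matVec_le (H := H) (e.norm_eq_one i)
  rwa [he, inner_smul_right, real_inner_self_eq_norm_sq, e.norm_eq_one, one_pow, mul_one] at this

theorem specNorm_le_of_abs_eigenvalue_le (hH : H.IsSymm)
    (he : ∀ i, matVec H (e i) = lam i • e i) {c : ℝ} (hc : 0 ≤ c) (h : ∀ i, |lam i| ≤ c) :
    specNorm H ≤ c := by
  refine ContinuousLinearMap.opNorm_le_bound _ hc fun x => ?_
  change ‖matVec H x‖ ≤ _
  rw [← sq_le_sq₀ (norm_nonneg _) (by positivity), mul_pow, ← e.sum_sq_inner_right,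
    ← e.sum_sq_inner_right x, Finset.mul_sum]
  refine Finset.sum_le_sum fun i _ => ?_
  rw [inner_eigenvector_matVec hH he, mul_pow, ← sq_abs (lam i)]
  gcongr
  exact h i

theorem matVec_neg (v : Vec n) : matVec (-H) v = -matVec H v := by
  rw [matVec, matVec, map_neg]
  rfl

theorem krylov_neg_le (j : ℕ) : krylov (-H) b j ≤ krylov H b j := by
  have hiter : ∀ i, (matVec (-H))^[i] b = (-1 : ℝ) ^ i • (matVec H)^[i] b := by
    intro i
    induction i with
    | zero => simp
    | succ i ih =>
      rw [Function.iterate_succ_apply', Function.iterate_succ_apply', ih, matVec_neg, matVec_smul,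
        pow_succ, mul_neg_one, neg_smul]
  refine Submodule.span_le.mpr ?_
  rintro _ ⟨i, hi, rfl⟩
  rw [hiter]
  exact Submodule.smul_mem _ _ (iterate_mem_krylov hi)

theorem neg_xiMin_neg_le_xiMax (hb : ‖b‖ = 1) {j : ℕ} (hj : 1 ≤ j) :
    -xiMin (-H) b j ≤ xiMax H b j := by
  obtain ⟨z, hz, hz1, h⟩ := exists_eq_xiMin (H := -H) hb hj
  rw [h, matVec_neg, inner_neg_right, neg_neg]
  exact le_xiMax_inner (krylov_neg_le j hz) hz1

/-- One of the extreme eigenvalues is the spectral norm up to sign, and the first phase finds it up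
to half of the norm; for the largest eigenvalue, the smallest Ritz value of `-H` is considered. -/
theorem specNorm_le_two_mul_max (hH : H.IsSymm) (he : ∀ i, matVec H (e i) = lam i • e i)
    {i₀ i₁ : Fin n} {δ : ℝ} (hmin : ∀ i, lam i₀ ≤ lam i) (hmax : ∀ i, lam i ≤ lam i₁)
    (hδ0 : 0 ≤ δ) (hb : ‖b‖ = 1) (hb0 : 2 * δ / (5 * √n) < |⟪e i₀, b⟫|)
    (hb1 : 2 * δ / (5 * √n) < |⟪e i₁, b⟫|) :
    specNorm H ≤ 2 * max |xiMax H b (jM n δ)| |xiMin H b (jM n δ)| := by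
  set h := specNorm H with hh
  have habs := abs_eigenvalue_le_specNorm he
  rw [← hh] at habs
  rcases le_or_gt h 0 with h0 | h0
  · exact h0.trans (by positivity)
  have hj := one_le_iterLimit i₀.pos δ 1
  have hc : 1 / 2 ≤ 1 * √(h / 2 / (2 * h)) := by
    rw [show h / 2 / (2 * h) = (1 / 2) ^ 2 by field_simp, Real.sqrt_sq (by norm_num)]
    norm_num
  have hle : h ≤ max (-lam i₀) (lam i₁) := by
    refine specNorm_le_of_abs_eigenvalue_le hH he ?_ fun i => ?_
    · by_contra! hneg
      have := max_lt_iff.mp hneg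
      linarith [hmin i₁]
    · rcases abs_cases (lam i) with ⟨ha, -⟩ | ⟨ha, -⟩ <;> rw [ha]
      · exact (hmax i).trans (le_max_right _ _)
      · exact (neg_le_neg (hmin i)).trans (le_max_left _ _)
  rcases le_max_iff.mp hle with hl | hl
  · have := xiMin_iterLimit_le hH he hmin (θ := h / 2) (R := 2 * h)
      (fun i => by linarith [abs_le.mp (habs i), abs_le.mp (habs i₀)]) (by positivity) hc hδ0 hb hb0
    have h2 := neg_le_abs (xiMin H b (jM n δ))
    have h3 := le_max_right |xiMax H b (jM n δ)| |xiMin H b (jM n δ)|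
    rw [← jM] at this
    linarith
  · have := xiMin_iterLimit_le (H := -H) (lam := fun i => -lam i) hH.neg
      (fun i => by rw [matVec_neg, he, neg_smul]) (fun i => neg_le_neg (hmax i)) (θ := h / 2)
      (R := 2 * h) (fun i => by linarith [abs_le.mp (habs i), abs_le.mp (habs i₁)]) (by positivity)
      hc hδ0 hb hb1
    have h1 := neg_xiMin_neg_le_xiMax (H := H) hb hj
    have h2 := le_abs_self (xiMax H b (jM n δ))
    have h3 := le_max_left |xiMax H b (jM n δ)| |xiMin H b (jM n δ)|
    rw [jM] at h2 h3 ⊢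
    linarith

/-- An upper bound `M` on the norm makes the iteration limit of the second phase sufficient. -/
theorem xiMin_jTotal_le (hH : H.IsSymm) (he : ∀ i, matVec H (e i) = lam i • e i)
    {i₀ : Fin n} {ε δ M : ℝ} (hmin : ∀ i, lam i₀ ≤ lam i) (hε : 0 < ε) (hδ0 : 0 ≤ δ)
    (hb : ‖b‖ = 1) (hb0 : 2 * δ / (5 * √n) < |⟪e i₀, b⟫|) (hM : specNorm H ≤ M) :
    xiMin H b (jTotal n ε δ M) ≤ lam i₀ + ε / 2 := by
  have habs := abs_eigenvalue_le_specNorm he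
  rcases le_or_gt M 0 with h0 | h0
  · -- Here `H = 0`, and every Ritz value is exact.
    have h1 := abs_le.mp (abs_xiMin_le (H := H) hb (one_le_iterLimit i₀.pos δ √(M / ε)))
    rw [jTotal]
    linarith [abs_le.mp (habs i₀)]
  · refine xiMin_iterLimit_le hH he hmin (R := 2 * M)
      (fun i => by linarith [abs_le.mp (habs i), abs_le.mp (habs i₀)]) (by positivity) ?_ hδ0 hb hb0
    rw [← Real.sqrt_mul (by positivity), show M / ε * (ε / 2 / (2 * M)) = (1 / 2) ^ 2 by
      field_simp, Real.sqrt_sq (by norm_num)]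

end Norm

theorem max_jM_jTotal_le_productBound {n : ℕ} (hn : 0 < n) {ε δ M h : ℝ} (hε : 0 < ε)
    (hδ0 : 0 ≤ δ) (hδ1 : δ < 1) (hM : M ≤ 2 * h) :
    max (jM n δ) (jTotal n ε δ M) ≤ productBound n ε δ h := by
  rw [jM, jTotal, iterLimit, iterLimit, productBound]
  split_ifs with hδ
  · simp
  have hδ' : 0 < δ := lt_of_le_of_ne hδ0 (Ne.symm hδ)
  have hn1 : (1 : ℝ) ≤ n := Nat.one_le_cast.mpr hn
  have hL : 0 ≤ 1 / 2 * Real.log (25 * n / δ ^ 2) := by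
    refine mul_nonneg (by norm_num) (Real.log_nonneg ?_)
    rw [one_le_div (by positivity)]
    nlinarith
  rw [mul_one]
  refine max_le (min_le_min_left _ (Nat.add_le_add_left (le_max_left _ _) _))
    (min_le_min_left _ (Nat.add_le_add_left (le_max_of_le_right ?_) _))
  exact Nat.ceil_mono (mul_le_mul_of_nonneg_left (Real.sqrt_le_sqrt (by gcongr)) hL)

/-! ### The guarantee of the method -/

/-- The first part says, for every starting vector, what the method computes; the second part is
the probabilistic guarantee. -/
theorem mainTheorem8 (n : ℕ) (hn : 0 < n) (H : Matrix (Fin n) (Fin n) ℝ) (hH : H.IsSymm)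
    (ε δ : ℝ) (hε : 0 < ε) (hδ0 : 0 ≤ δ) (hδ1 : δ < 1) :
    (∀ b : Metric.sphere (0 : Vec n) 1,
      let out := ((adaptiveLanczos ε δ (b : Vec n)).run H).1
      out.normEst = 2 * max |xiMax H b (jM n δ)| |xiMin H b (jM n δ)| ∧
      out.eigEst = xiMin H b (jTotal n ε δ out.normEst) ∧
      (out.direction = none ↔ -ε / 2 < out.eigEst) ∧
      (∀ v, out.direction = some v → ‖v‖ = 1 ∧ inner ℝ v (matVec H v) = out.eigEst)) ∧
    ∃ A : Set (Metric.sphere (0 : Vec n) 1), MeasurableSet A ∧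
      ENNReal.ofReal (1 - δ) ≤ uniformSphere n A ∧
      ∀ b ∈ A,
        let out := ((adaptiveLanczos ε δ (b : Vec n)).run H).1
        let products := ((adaptiveLanczos ε δ (b : Vec n)).run H).2
        specNorm H ≤ out.normEst ∧ out.normEst ≤ 2 * specNorm H ∧
        out.eigEst ≤ lambdaMin H + ε / 2 ∧
        products ≤ productBound n ε δ (specNorm H) := by
  have hunit : ∀ b : Metric.sphere (0 : Vec n) 1, ‖(b : Vec n)‖ = 1 := fun b =>
    mem_sphere_zero_iff_norm.mp b.2
  constructor
  · intro b
    obtain ⟨h1, h2, h3, h4, -⟩ := adaptiveLanczos_run hn hH ε δ (hunit b) rfl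
    exact ⟨h1, h2, h3, h4⟩
  · obtain ⟨e, lam, he, hspec⟩ := exists_eigenbasis hH
    have : Nonempty (Fin n) := ⟨⟨0, hn⟩⟩
    obtain ⟨i₀, hmin⟩ := Finite.exists_min lam
    obtain ⟨i₁, hmax⟩ := Finite.exists_max lam
    have hlam : lambdaMin H = lam i₀ := by
      rw [lambdaMin, hspec]
      exact IsLeast.csInf_eq ⟨⟨i₀, rfl⟩, by rintro _ ⟨i, rfl⟩; exact hmin i⟩
    refine ⟨_, ((measurableSet_abs_inner_le (e i₀) _).union
      (measurableSet_abs_inner_le (e i₁) _)).compl,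
      le_uniformSphere_lt_abs_inner e i₀ i₁ hδ0, fun b hb => ?_⟩
    have hb0 : 2 * δ / (5 * √n) < |⟪e i₀, (b : Vec n)⟫| := not_le.mp fun h => hb (Or.inl h)
    have hb1 : 2 * δ / (5 * √n) < |⟪e i₁, (b : Vec n)⟫| := not_le.mp fun h => hb (Or.inr h)
    intro out products
    obtain ⟨hest, heig, -, -, hcount⟩ :=
      adaptiveLanczos_run hn hH ε δ (hunit b) (out := out) rfl
    have hlow : specNorm H ≤ out.normEst := by
      rw [hest]
      exact specNorm_le_two_mul_max hH he hmin hmax hδ0 (hunit b) hb0 hb1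
    have hupp : out.normEst ≤ 2 * specNorm H := by
      rw [hest]
      have hj := one_le_iterLimit hn δ 1
      exact mul_le_mul_of_nonneg_left
        (max_le (abs_xiMax_le (hunit b) hj) (abs_xiMin_le (hunit b) hj)) zero_le_two
    refine ⟨hlow, hupp, ?_, hcount.trans (max_jM_jTotal_le_productBound hn hε hδ0 hδ1 hupp)⟩
    rw [heig, hlam]
    exact xiMin_jTotal_le hH he hmin hε hδ0 (hunit b) hb0 hlow
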